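/- Let $k\ge 1$, let $w_1,\dots,w_k>0$, and for each $i$ let $M_i$ be a metric space (finite or infinite) in which any two distinct points are at distance exactly $w_i$. In the generalized $k$-server problem on $M_1,\dots,M_k$ there is one server $s_i$ in each $M_i$; a configuration is a tuple $q\in\prod_i M_i$ of server positions, and passing from $p$ to $q$ costs $\sum_i d_i(p_i,q_i)$. Requests $r=(r_1,\dots,r_k)\in\prod_i M_i$ arrive one by one, and each must be served on arrival by moving to a configuration $q$ with $q_i=r_i$ for at least one $i$. A deterministic online algorithm chooses each configuration as a function of the initial configuration and of the requests that have arrived so far. For a finite request sequence $\sigma$ and an initial configuration $q_0$, let $\mathrm{ALG}(q_0,\sigma)$ be the total cost of the algorithm, and let $\mathrm{OPT}(q_0,\sigma)$ be the infimum of the total costs of all sequences of configurations that start in $q_0$ and serve $\sigma$ in order. Then there is a deterministic online algorithm that is $2^{2^{k+3}}$-competitive: there is a constant $b$, independent of $q_0$ and $\sigma$, such that for all $q_0$ and all finite $\sigma$, $$\mathrm{ALG}(q_0,\sigma)\;\le\;2^{2^{k+3}}\cdot \mathrm{OPT}(q_0,\sigma)+b .$$ -/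

import Mathlib

namespace GenKServer

/-- A configuration of the `k` servers: server `i` is at a point of its own space `M i`. -/
abbrev Config {k : ℕ} (M : Fin k → Type*) := ∀ i, M i

/-- A request is a `k`-tuple with one point in each space. -/
abbrev Request {k : ℕ} (M : Fin k → Type*) := ∀ i, M i

/-- A configuration is feasible for a request if some server is at its requested point. -/
def Serves {k : ℕ} {M : Fin k → Type*} (q : Config M) (r : Request M) : Prop :=
  ∃ i, q i = r i

/-- The total distance travelled by the servers when passing from `p` to `q`. -/
noncomputable def moveCost {k : ℕ} {M : Fin k → Type*} [∀ i, MetricSpace (M i)]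
    (p q : Config M) : ℝ :=
  ∑ i, dist (p i) (q i)

/-- The cost of the first `T` steps of a sequence of configurations. -/
noncomputable def pathCost {k : ℕ} {M : Fin k → Type*} [∀ i, MetricSpace (M i)]
    (q : ℕ → Config M) (T : ℕ) : ℝ :=
  ∑ t ∈ Finset.range T, moveCost (q t) (q (t + 1))

/-- `q` is a valid (offline) solution for the request sequence `σ` from the initial configuration
`q₀`: it starts in `q₀`, and the configuration after the `t`-th move serves the `t`-th request. -/
def IsSolution {k : ℕ} {M : Fin k → Type*} (q₀ : Config M) (σ : List (Request M))
    (q : ℕ → Config M) : Prop :=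
  q 0 = q₀ ∧ ∀ (t : ℕ) (ht : t < σ.length), Serves (q (t + 1)) σ[t]

/-- The costs of all valid offline solutions. -/
def offlineCosts {k : ℕ} {M : Fin k → Type*} [∀ i, MetricSpace (M i)]
    (q₀ : Config M) (σ : List (Request M)) : Set ℝ :=
  {c | ∃ q : ℕ → Config M, IsSolution q₀ σ q ∧ pathCost q σ.length = c}

/-- The optimal offline cost. -/
noncomputable def optCost {k : ℕ} {M : Fin k → Type*} [∀ i, MetricSpace (M i)]
    (q₀ : Config M) (σ : List (Request M)) : ℝ :=
  sInf (offlineCosts q₀ σ)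

/-- The infimum defining `optCost` is over a set that is bounded below. -/
theorem offlineCosts_bddBelow {k : ℕ} {M : Fin k → Type*} [∀ i, MetricSpace (M i)]
    (q₀ : Config M) (σ : List (Request M)) : BddBelow (offlineCosts q₀ σ) := by
  refine ⟨0, ?_⟩
  rintro c ⟨q, -, rfl⟩
  exact Finset.sum_nonneg fun t _ => Finset.sum_nonneg fun i _ => dist_nonneg

/-- The infimum defining `optCost` is over a nonempty set as soon as there is a server. -/
theorem offlineCosts_nonempty {k : ℕ} (hk : 1 ≤ k) {M : Fin k → Type*} [∀ i, MetricSpace (M i)]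
    (q₀ : Config M) (σ : List (Request M)) : (offlineCosts q₀ σ).Nonempty := by
  refine ⟨_, fun t => Nat.casesOn t q₀ (fun s => σ.getD s q₀), ⟨rfl, fun t ht => ?_⟩, rfl⟩
  exact ⟨⟨0, hk⟩, by simp [ht]⟩

/-- A deterministic online algorithm: after the initial configuration `q₀` and a finite sequence of
requests it is in a configuration determined by these data alone (hence not by future requests),
and it serves every request when it arrives. -/
structure OnlineAlgorithm {k : ℕ} (M : Fin k → Type*) where
  /-- the configuration after the requests in the list have been served, oldest request first -/
  state : Config M → List (Request M) → Config M
  state_nil : ∀ q₀, state q₀ [] = q₀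
  state_serves : ∀ q₀ past r, Serves (state q₀ (past ++ [r])) r

/-- The total cost of an online algorithm on the request sequence `σ`. -/
noncomputable def OnlineAlgorithm.cost {k : ℕ} {M : Fin k → Type*} [∀ i, MetricSpace (M i)]
    (A : OnlineAlgorithm M) (q₀ : Config M) (σ : List (Request M)) : ℝ :=
  pathCost (fun t => A.state q₀ (σ.take t)) σ.length

/-- `A` is `c`-competitive: up to an additive constant, independent of the request sequence (and of
the initial configuration), its cost is at most `c` times the optimal offline cost. -/
def OnlineAlgorithm.IsCompetitive {k : ℕ} {M : Fin k → Type*} [∀ i, MetricSpace (M i)]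
    (A : OnlineAlgorithm M) (c : ℝ) : Prop :=
  ∃ b : ℝ, ∀ (q₀ : Config M) (σ : List (Request M)), A.cost q₀ σ ≤ c * optCost q₀ σ + b

/-- Weighted uniform metrics: all distances between distinct points of `M i` equal `w i > 0`. -/
def IsWeightedUniform {k : ℕ} (M : Fin k → Type*) [∀ i, MetricSpace (M i)]
    (w : Fin k → ℝ) : Prop :=
  ∀ i, 0 < w i ∧ ∀ x y : M i, x ≠ y → dist x y = w i

end GenKServer

/-! Induction on the number of servers, adding a heaviest server `m` to a lighter set `S` of `ℓ`
servers. Put `N = mergeBound ℓ`. In a round `m` stays put and the algorithm for `S` handles the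
requests that `m` misses, as long as they are servable offline by `S` at cost `W`, a constant
multiple of `w m`. Hence a round costs a constant multiple of `w m`. Afterwards `m` jumps to a point
`p` such that `S` could have served all requests of the phase not asking for `p` at cost `w m`. If
there is none, a new phase begins.

A completed phase costs every offline solution at least `w m`: either its server `m` moves, or it
rests at some `p` and `S` pays more than `w m` (`Servable.drop`).

A phase has at most `N + 1` rounds. The targets of the jumps are distinct, and the list `T` that
broke the first round is not servable at cost `W`, although for each target `q` the requests of `T`
not asking for `q` are servable at cost `w m`. Each request of `T` is missed by at most one of these
solutions, so `N + 1` of them could be merged into a cheap solution for all of `T` (`exists_merge`,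
`servable_of_filter`), a contradiction. The bound `N`, and with it the ratio, is doubly exponential
because merging squares it for each server. -/

namespace GenKServer

/-! ### Offline solutions with a free starting configuration -/

section Servable

variable {ι : Type*} {M : ι → Type*}

/-- Some server in `S` is at its requested point. -/
def ServedBy (S : Finset ι) (q r : ∀ i, M i) : Prop := ∃ i ∈ S, q i = r i

open Classical in
/-- The weighted number of servers in `S` whose positions differ in `p` and `q`. -/
noncomputable def switchCost (w : ι → ℝ) (S : Finset ι) (p q : ∀ i, M i) : ℝ :=
  ∑ i ∈ S, if p i = q i then 0 else w i

/-- The total switching cost along a list of configurations. -/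
noncomputable def listCost (w : ι → ℝ) (S : Finset ι) : List (∀ i, M i) → ℝ
  | [] => 0
  | [_] => 0
  | x :: y :: l => switchCost w S x y + listCost w S (y :: l)

/-- The requests in `T` can be served by the servers in `S` at cost at most `c`, from an initial
configuration of our choice. -/
def Servable (w : ι → ℝ) (S : Finset ι) (T : List (∀ i, M i)) (c : ℝ) : Prop :=
  ∃ xs : List (∀ i, M i), List.Forall₂ (ServedBy S) xs T ∧ listCost w S xs ≤ c

variable {w : ι → ℝ} {S : Finset ι}

theorem switchCost_self (p : ∀ i, M i) : switchCost w S p p = 0 := by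
  simp [switchCost]

theorem switchCost_nonneg (hw : ∀ i, 0 < w i) (p q : ∀ i, M i) : 0 ≤ switchCost w S p q :=
  Finset.sum_nonneg fun i _ => by split_ifs <;> simp [(hw i).le]

theorem le_switchCost (hw : ∀ i, 0 < w i) {p q : ∀ i, M i} {i : ι} (hi : i ∈ S)
    (h : p i ≠ q i) : w i ≤ switchCost w S p q := by
  classical
  have := Finset.single_le_sum (f := fun i => if p i = q i then 0 else w i)
    (fun i _ => by split_ifs <;> simp [(hw i).le]) hi
  rw [if_neg h] at this
  exact this

theorem switchCost_triangle (hw : ∀ i, 0 < w i) (p q r : ∀ i, M i) :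
    switchCost w S p r ≤ switchCost w S p q + switchCost w S q r := by
  classical
  unfold switchCost
  rw [← Finset.sum_add_distrib]
  refine Finset.sum_le_sum fun i _ => ?_
  have := (hw i).le
  by_cases h1 : p i = q i
  · simp [h1]
  · simp only [h1, if_false]
    split_ifs <;> linarith

theorem switchCost_le_card (hw : ∀ i, 0 < w i) {W : ℝ} (hW : ∀ i ∈ S, w i ≤ W)
    (p q : ∀ i, M i) : switchCost w S p q ≤ S.card * W := by
  classical
  rw [← nsmul_eq_mul]
  refine Finset.sum_le_card_nsmul _ _ _ fun i hi => ?_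
  have := (hw i).le.trans (hW i hi)
  split_ifs
  exacts [this, hW i hi]

theorem switchCost_insert [DecidableEq ι] {m : ι} (hm : m ∉ S) (p q : ∀ i, M i)
    [Decidable (p m = q m)] :
    switchCost w (insert m S) p q = (if p m = q m then 0 else w m) + switchCost w S p q := by
  unfold switchCost
  rw [Finset.sum_insert hm]
  congr

theorem switchCost_congr {p q p' q' : ∀ i, M i} (hp : ∀ i ∈ S, p i = p' i)
    (hq : ∀ i ∈ S, q i = q' i) : switchCost w S p q = switchCost w S p' q' := by
  classical
  exact Finset.sum_congr rfl fun i hi => by rw [hp i hi, hq i hi]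

theorem switchCost_mono (hw : ∀ i, 0 < w i) {S' : Finset ι} (h : S' ⊆ S) (p q : ∀ i, M i) :
    switchCost w S' p q ≤ switchCost w S p q :=
  Finset.sum_le_sum_of_subset_of_nonneg h fun i _ _ => by split_ifs <;> simp [(hw i).le]

theorem listCost_nonneg (hw : ∀ i, 0 < w i) : ∀ l : List (∀ i, M i), 0 ≤ listCost w S l
  | [] => le_rfl
  | [_] => le_rfl
  | x :: y :: l => add_nonneg (switchCost_nonneg hw x y) (listCost_nonneg hw (y :: l))

theorem listCost_mono (hw : ∀ i, 0 < w i) {S' : Finset ι} (h : S' ⊆ S) :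
    ∀ l : List (∀ i, M i), listCost w S' l ≤ listCost w S l
  | [] => le_rfl
  | [_] => le_rfl
  | x :: y :: l => add_le_add (switchCost_mono hw h x y) (listCost_mono hw h (y :: l))

theorem listCost_le_cons (hw : ∀ i, 0 < w i) (x : ∀ i, M i) :
    ∀ l, listCost w S l ≤ listCost w S (x :: l)
  | [] => le_rfl
  | y :: _ => le_add_of_nonneg_left (switchCost_nonneg hw x y)

theorem listCost_cons_cons_le (hw : ∀ i, 0 < w i) (x y : ∀ i, M i) :
    ∀ l, listCost w S (x :: l) ≤ listCost w S (x :: y :: l)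
  | [] => add_nonneg (switchCost_nonneg hw x y) le_rfl
  | z :: l => by
    have := switchCost_triangle (S := S) hw x y z
    simp only [listCost]
    linarith

/-- Skipping a configuration is a shortcut, by the triangle inequality. The fixed head `x` makes the
induction work. -/
theorem listCost_cons_sublist (hw : ∀ i, 0 < w i) {l' l : List (∀ i, M i)} (h : l'.Sublist l) :
    ∀ x, listCost w S (x :: l') ≤ listCost w S (x :: l) := by
  induction h with
  | slnil => exact fun x => le_rfl
  | cons y _ ih => exact fun x => (ih x).trans (listCost_cons_cons_le hw x y _)
  | cons_cons y _ ih => exact fun x => add_le_add le_rfl (ih y)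

theorem listCost_sublist (hw : ∀ i, 0 < w i) {l' l : List (∀ i, M i)} (h : l'.Sublist l) :
    listCost w S l' ≤ listCost w S l := by
  induction h with
  | slnil => exact le_rfl
  | cons y _ ih => exact ih.trans (listCost_le_cons hw y _)
  | cons_cons y h _ => exact listCost_cons_sublist hw h y

theorem listCost_append (x : ∀ i, M i) (l' : List (∀ i, M i)) :
    ∀ l, listCost w S (l ++ x :: l') = listCost w S (l ++ [x]) + listCost w S (x :: l')
  | [] => by simp [listCost]
  | [y] => by simp [listCost]
  | y :: z :: l => by
    have := listCost_append x l' (z :: l)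
    simp only [List.cons_append, listCost] at this ⊢
    rw [this, add_assoc]

theorem forall₂_sublist {α β : Type*} {R : α → β → Prop} {T' T : List β} (h : T'.Sublist T) :
    ∀ {xs : List α}, List.Forall₂ R xs T → ∃ xs', xs'.Sublist xs ∧ List.Forall₂ R xs' T' := by
  induction h with
  | slnil => exact fun {xs} hx => ⟨xs, List.Sublist.refl _, hx⟩
  | cons r _ ih =>
    rintro _ (_ | ⟨_, hx⟩)
    obtain ⟨xs', h1, h2⟩ := ih hx
    exact ⟨xs', h1.cons _, h2⟩
  | cons_cons r _ ih =>
    rintro _ (_ | ⟨hr, hx⟩)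
    obtain ⟨xs', h1, h2⟩ := ih hx
    exact ⟨_, h1.cons_cons _, h2.cons hr⟩

theorem Servable.nonneg (hw : ∀ i, 0 < w i) {T : List (∀ i, M i)} {c : ℝ}
    (h : Servable w S T c) : 0 ≤ c := by
  obtain ⟨xs, -, h⟩ := h
  exact (listCost_nonneg hw xs).trans h

theorem Servable.sublist (hw : ∀ i, 0 < w i) {T T' : List (∀ i, M i)} {c : ℝ}
    (h : Servable w S T c) (hT : T'.Sublist T) : Servable w S T' c := by
  obtain ⟨xs, h1, h2⟩ := h
  obtain ⟨xs', h3, h4⟩ := forall₂_sublist hT h1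
  exact ⟨xs', h4, (listCost_sublist hw h3).trans h2⟩

theorem Servable.mono {T : List (∀ i, M i)} {c c' : ℝ} (h : Servable w S T c) (hc : c ≤ c') :
    Servable w S T c' := by
  obtain ⟨xs, h1, h2⟩ := h
  exact ⟨xs, h1, h2.trans hc⟩

theorem servable_nil {c : ℝ} (hc : 0 ≤ c) : Servable w S ([] : List (∀ i, M i)) c :=
  ⟨[], .nil, hc⟩

theorem Servable.eq_nil {T : List (∀ i, M i)} {c : ℝ} (h : Servable w ∅ T c) : T = [] := by
  obtain ⟨xs, h, -⟩ := h
  cases h with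
  | nil => rfl
  | cons h _ => obtain ⟨i, hi, -⟩ := h; simp at hi

open Classical in
theorem forall₂_filter_of_const [DecidableEq ι] {m : ι} {p : M m} :
    ∀ {xs T : List (∀ i, M i)}, List.Forall₂ (ServedBy (insert m S)) xs T →
      (∀ x ∈ xs, x m = p) →
      ∃ xs', xs'.Sublist xs ∧ List.Forall₂ (ServedBy S) xs' (T.filter (fun r => r m ≠ p))
  | _, _, .nil, _ => ⟨[], .slnil, .nil⟩
  | x :: xs, r :: T, .cons hr h, hx => by
    obtain ⟨xs', h1, h2⟩ := forall₂_filter_of_const h fun y hy => hx y (by simp [hy])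
    by_cases hrp : r m = p
    · exact ⟨xs', h1.cons _, by simpa [hrp] using h2⟩
    · refine ⟨x :: xs', h1.cons_cons _, ?_⟩
      have : ServedBy S x r := by
        obtain ⟨i, hi, hxr⟩ := hr
        rcases Finset.mem_insert.1 hi with rfl | hi
        · exact absurd (hxr.symm.trans (hx x (by simp))) hrp
        · exact ⟨i, hi, hxr⟩
      rw [List.filter_cons_of_pos (by simpa using hrp)]
      exact .cons this h2

theorem eq_of_listCost_lt (hw : ∀ i, 0 < w i) {m : ι} (hm : m ∈ S) :
    ∀ {x : ∀ i, M i} {l : List (∀ i, M i)}, listCost w S (x :: l) < w m →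
      ∀ y ∈ x :: l, y m = x m
  | x, [], _, y, hy => by simp_all
  | x, z :: l, h, y, hy => by
    simp only [listCost] at h
    have h1 := switchCost_nonneg (S := S) hw x z
    have h2 := listCost_nonneg (S := S) hw (z :: l)
    have hxz : x m = z m := by
      by_contra hne
      linarith [le_switchCost hw hm hne]
    rcases List.mem_cons.1 hy with rfl | hy
    · rfl
    · rw [hxz]
      exact eq_of_listCost_lt hw hm (by linarith) y hy

open Classical in
/-- If the requests `T` cannot be served at cost at most `w m` by the servers in `S` with the help
of a server `m` that stays put, then serving them costs at least `w m`. -/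
theorem Servable.drop [DecidableEq ι] (hw : ∀ i, 0 < w i) {m : ι} {T τ : List (∀ i, M i)}
    {r : ∀ i, M i} {c : ℝ}
    (h : ∀ p, ¬ Servable w S ((T ++ [r]).filter (fun r => r m ≠ p)) (w m))
    (hT : Servable w (insert m S) (T ++ r :: τ) c) :
    Servable w (insert m S) (r :: τ) (c - w m) := by
  obtain ⟨xs, h1, h2⟩ := hT
  obtain ⟨ys, zs', rfl, hys, hzs⟩ : ∃ ys zs, xs = ys ++ zs ∧
      List.Forall₂ (ServedBy (insert m S)) ys T ∧
      List.Forall₂ (ServedBy (insert m S)) zs (r :: τ) :=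
    ⟨_, _, (List.take_append_drop T.length xs).symm,
      List.forall₂_take_append _ _ _ h1, List.forall₂_drop_append _ _ _ h1⟩
  cases hzs with
  | cons hr hzs =>
    rename_i x zs
    refine ⟨x :: zs, .cons hr hzs, ?_⟩
    rw [listCost_append] at h2
    -- The cost splits at `x`, the configuration serving `r`, which belongs to both halves. If the
    -- first half cost less than `w m`, server `m` would rest at one point `p` throughout it, and
    -- `S` alone would serve the rest at cost at most `w m`, contrary to `h`.
    suffices w m ≤ listCost w (insert m S) (ys ++ [x]) by linarith
    by_contra! hlt
    have hall : List.Forall₂ (ServedBy (insert m S)) (ys ++ [x]) (T ++ [r]) :=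
      List.rel_append hys (.cons hr .nil)
    obtain ⟨p, hp⟩ : ∃ p, ∀ y ∈ ys ++ [x], y m = p := by
      cases ys with
      | nil => exact ⟨x m, by simp⟩
      | cons y ys => exact ⟨y m, eq_of_listCost_lt hw (Finset.mem_insert_self m S) hlt⟩
    obtain ⟨xs', h3, h4⟩ := forall₂_filter_of_const hall hp
    exact h p ⟨xs', h4, (listCost_sublist hw h3).trans
      ((listCost_mono hw (Finset.subset_insert m S) _).trans hlt.le)⟩

theorem servable_of_path (σ : List (∀ i, M i)) :
    ∀ q : ℕ → ∀ i, M i, (∀ (t : ℕ) (ht : t < σ.length), ServedBy S (q (t + 1)) σ[t]) →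
      ∃ xs, List.Forall₂ (ServedBy S) xs σ ∧ listCost w S (q 0 :: xs) ≤
        ∑ t ∈ Finset.range σ.length, switchCost w S (q t) (q (t + 1)) := by
  induction σ with
  | nil => exact fun q _ => ⟨[], .nil, by simp [listCost]⟩
  | cons r σ ih =>
    intro q hq
    obtain ⟨xs, h1, h2⟩ := ih (fun t => q (t + 1)) fun t ht => hq (t + 1) (by simpa using ht)
    refine ⟨q 1 :: xs, .cons (hq 0 (by simp)) h1, ?_⟩
    rw [List.length_cons, Finset.sum_range_succ', add_comm]
    exact add_le_add le_rfl h2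

end Servable

/-! ### Merging many partial solutions into one -/

section Merge

variable {ι : Type*} {M : ι → Type*} {w : ι → ℝ}

/-- A family of more than `mergeBound ℓ` configurations of `ℓ` servers, almost all of which serve
given requests, can be merged into a single one. -/
def mergeBound : ℕ → ℕ
  | 0 => 1
  | ℓ + 1 => 2 * mergeBound ℓ ^ 2

theorem mergeBound_pos (ℓ : ℕ) : 0 < mergeBound ℓ := by
  induction ℓ with
  | zero => exact one_pos
  | succ ℓ ih => exact Nat.mul_pos two_pos (pow_pos ih 2)

theorem two_mul_mergeBound (ℓ : ℕ) : 2 * mergeBound ℓ = 2 ^ 2 ^ ℓ := by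
  induction ℓ with
  | zero => rfl
  | succ ℓ ih => rw [mergeBound, pow_succ 2 ℓ, pow_mul, ← ih]; ring

open Classical in
/-- Merging a family of configurations into one that serves each request served by all but a
small fraction of the family, and that moves only when the family moves. -/
theorem exists_merge [Nonempty (∀ i, M i)] (hw : ∀ i, 0 < w i) (J : Type*) (S : Finset ι) :
    ∃ Φ : Finset J → (J → ∀ i, M i) → ∀ i, M i,
      (∀ Q x r, (Q.filter fun j => ¬ ServedBy S (x j) r).card * mergeBound S.card < Q.card →
        ServedBy S (Φ Q x) r) ∧
      ∀ Q x x', switchCost w S (Φ Q x) (Φ Q x') ≤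
        S.card * ∑ j ∈ Q, switchCost w S (x j) (x' j) := by
  induction S using Finset.induction_on_max_value w with
  | empty =>
    refine ⟨fun _ _ => Classical.arbitrary _, fun Q x r h => ?_, fun Q x x' => ?_⟩
    · simp [ServedBy, mergeBound] at h
    · simp [switchCost]
  | insert m S hm hmax ih =>
    obtain ⟨Φ, hserve, hcost⟩ := ih
    -- Popular points hold server `m` in at least a fraction `1 / (2 * mergeBound S.card)` of the
    -- family. If there is one, `m` goes there and only that subfamily is merged further; otherwise
    -- the position of `m` is irrelevant. The choice depends only on the positions of `m` in the
    -- family.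
    let popular (Q : Finset J) (x : J → ∀ i, M i) (p : M m) : Prop :=
      Q.card ≤ (Q.filter fun j => x j m = p).card * (2 * mergeBound S.card)
    let Ψ (Q : Finset J) (x : J → ∀ i, M i) : ∀ i, M i :=
      if h : ∃ p, popular Q x p then
        Function.update (Φ (Q.filter fun j => x j m = h.choose) x) m h.choose
      else Function.update (Φ Q x) m (Classical.arbitrary (∀ i, M i) m)
    have hlift : ∀ {q r : ∀ i, M i} (p : M m), ServedBy S q r →
        ServedBy (insert m S) (Function.update q m p) r := by
      rintro q r p ⟨i, hi, hqr⟩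
      refine ⟨i, Finset.mem_insert_of_mem hi, ?_⟩
      rwa [Function.update_of_ne (ne_of_mem_of_not_mem hi hm)]
    have hpos := mergeBound_pos S.card
    refine ⟨Ψ, fun Q x r h => ?_, fun Q x x' => ?_⟩
    · rw [Finset.card_insert_of_notMem hm, mergeBound] at h
      by_cases hp : ∃ p, popular Q x p
      · simp only [Ψ, dif_pos hp]
        have hpop := hp.choose_spec
        set p := hp.choose
        by_cases hr : r m = p
        · exact ⟨m, Finset.mem_insert_self _ _, by simp [hr]⟩
        refine hlift p (hserve _ _ _ ?_)
        -- Within the subfamily `m` is at `p ≠ r m`, so a member that fails with `S` fails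
        -- altogether. The failures stay the same while the family shrinks by at most the factor `2
        -- * mergeBound S.card`.
        have hle : ((Q.filter fun j => x j m = p).filter fun j => ¬ ServedBy S (x j) r).card ≤
            (Q.filter fun j => ¬ ServedBy (insert m S) (x j) r).card := by
          refine Finset.card_le_card fun j hj => ?_
          simp only [Finset.mem_filter] at hj ⊢
          refine ⟨hj.1.1, ?_⟩
          rintro ⟨i, hi, hx⟩
          rcases Finset.mem_insert.1 hi with rfl | hi
          · exact hr (hx.symm.trans hj.1.2)
          · exact hj.2 ⟨i, hi, hx⟩
        have h1 := lt_of_lt_of_le h hpop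
        refine lt_of_le_of_lt (Nat.mul_le_mul_right _ hle) ?_
        refine lt_of_mul_lt_mul_right (a := 2 * mergeBound S.card) ?_ (Nat.zero_le _)
        refine lt_of_eq_of_lt ?_ h1
        ring
      · simp only [Ψ, dif_neg hp]
        refine hlift _ (hserve _ _ _ ?_)
        -- As `r m` is unpopular, giving up `m` adds few failures: each of the two sources
        -- contributes less than half of the admissible fraction `1 / mergeBound S.card`.
        have hrm : (Q.filter fun j => x j m = r m).card * (2 * mergeBound S.card) < Q.card :=
          not_le.1 fun hle => hp ⟨r m, hle⟩
        have hle : (Q.filter fun j => ¬ ServedBy S (x j) r).card ≤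
            (Q.filter fun j => ¬ ServedBy (insert m S) (x j) r).card +
              (Q.filter fun j => x j m = r m).card := by
          refine (Finset.card_le_card fun j hj => ?_).trans (Finset.card_union_le _ _)
          simp only [Finset.mem_filter, Finset.mem_union] at hj ⊢
          by_cases hx : x j m = r m
          · exact Or.inr ⟨hj.1, hx⟩
          refine Or.inl ⟨hj.1, ?_⟩
          rintro ⟨i, hi, hxi⟩
          rcases Finset.mem_insert.1 hi with rfl | hi
          · exact hx hxi
          · exact hj.2 ⟨i, hi, hxi⟩
        have h2 := Nat.mul_le_mul_right (2 * mergeBound S.card) hle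
        have h3 : (Q.filter fun j => ¬ ServedBy (insert m S) (x j) r).card *
            (2 * mergeBound S.card) < Q.card := by
          refine lt_of_le_of_lt (Nat.mul_le_mul_left _ ?_) h
          nlinarith
        nlinarith
    · have hsum : ∀ Q' ⊆ Q, (S.card : ℝ) * ∑ j ∈ Q', switchCost w S (x j) (x' j) ≤
          (insert m S).card * ∑ j ∈ Q, switchCost w (insert m S) (x j) (x' j) := by
        intro Q' hQ'
        refine mul_le_mul ?_ ?_ (Finset.sum_nonneg fun j _ => switchCost_nonneg hw _ _)
          (Nat.cast_nonneg _)
        · exact_mod_cast Finset.card_le_card (Finset.subset_insert m S)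
        · exact (Finset.sum_le_sum_of_subset_of_nonneg hQ'
            fun j _ _ => switchCost_nonneg hw _ _).trans
            (Finset.sum_le_sum fun j _ => switchCost_mono hw (Finset.subset_insert m S) _ _)
      have hupd : ∀ (a b : ∀ i, M i) (p : M m), switchCost w (insert m S)
          (Function.update a m p) (Function.update b m p) = switchCost w S a b := by
        intro a b p
        rw [switchCost_insert hm]
        simp only [Function.update_self, if_true, zero_add]
        exact switchCost_congr
          (fun i hi => Function.update_of_ne (ne_of_mem_of_not_mem hi hm) _ _)
          (fun i hi => Function.update_of_ne (ne_of_mem_of_not_mem hi hm) _ _)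
      -- If no member of the family moves `m`, the popular points, the chosen one and the subfamily
      -- are unchanged. Otherwise the family pays at least `w m`, and since `m` is heaviest this
      -- pays for moving every server.
      by_cases hx : ∀ j ∈ Q, x j m = x' j m
      · have hfil : ∀ p, (Q.filter fun j => x' j m = p) = Q.filter fun j => x j m = p :=
          fun p => Finset.filter_congr fun j hj => by rw [hx j hj]
        have hpp : popular Q x' = popular Q x := by
          funext p
          simp only [popular, hfil]
        simp only [Ψ, hpp, hfil]
        split_ifs with hp
        · rw [hupd]
          exact (hcost _ _ _).trans (hsum _ (Finset.filter_subset _ _))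
        · rw [hupd]
          exact (hcost _ _ _).trans (hsum _ subset_rfl)
      · push Not at hx
        obtain ⟨j, hj, hne⟩ := hx
        have hmax' : ∀ i ∈ insert m S, w i ≤ w m := by
          intro i hi
          rcases Finset.mem_insert.1 hi with rfl | hi
          · exact le_rfl
          · exact hmax i hi
        refine (switchCost_le_card hw hmax' _ _).trans
          (mul_le_mul_of_nonneg_left ?_ (Nat.cast_nonneg _))
        refine (le_switchCost hw (Finset.mem_insert_self m S) hne).trans ?_
        exact Finset.single_le_sum (f := fun j => switchCost w (insert m S) (x j) (x' j))
          (fun j _ => switchCost_nonneg hw _ _) hj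

theorem listCost_map_le {J : Type*} {S : Finset ι} {Q : Finset J}
    {f : (J → ∀ i, M i) → ∀ i, M i} {C : ℝ}
    (hf : ∀ x x', switchCost w S (f x) (f x') ≤ C * ∑ j ∈ Q, switchCost w S (x j) (x' j)) :
    ∀ Z : List (J → ∀ i, M i),
      listCost w S (Z.map f) ≤ C * ∑ j ∈ Q, listCost w S (Z.map fun x => x j)
  | [] => by simp [listCost]
  | [x] => by simp [listCost]
  | x :: y :: Z => by
    have h := listCost_map_le hf (y :: Z)
    simp only [List.map_cons, listCost, Finset.sum_add_distrib, mul_add] at h ⊢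
    exact add_le_add (hf x y) h

/-- At a request that is filtered out the solution repeats its current configuration, here `x₀`. -/
theorem exists_extend_filter_from {S : Finset ι} (P : (∀ i, M i) → Bool) :
    ∀ (T xs : List (∀ i, M i)), List.Forall₂ (ServedBy S) xs (T.filter P) → ∀ x₀,
      ∃ ys, List.Forall₂ (fun x r => P r = true → ServedBy S x r) ys T ∧
        listCost w S (x₀ :: ys) = listCost w S (x₀ :: xs)
  | [], _, .nil, _ => ⟨[], .nil, rfl⟩
  | r :: T, xs, h, x₀ => by
    by_cases hr : P r = true
    · rw [List.filter_cons_of_pos hr] at h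
      cases h with
      | cons hx h =>
        rename_i x xs
        obtain ⟨ys, h1, h2⟩ := exists_extend_filter_from P T xs h x
        exact ⟨x :: ys, .cons (fun _ => hx) h1, by simp only [listCost, h2]⟩
    · rw [List.filter_cons_of_neg hr] at h
      obtain ⟨ys, h1, h2⟩ := exists_extend_filter_from P T xs h x₀
      exact ⟨x₀ :: ys, .cons (fun h => absurd h hr) h1,
        by rw [listCost, switchCost_self, zero_add, h2]⟩

/-- A solution for a filtered list extends to the whole list without additional cost. -/
theorem Servable.extend_filter [Nonempty (∀ i, M i)] (hw : ∀ i, 0 < w i) {S : Finset ι}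
    {P : (∀ i, M i) → Bool} {T : List (∀ i, M i)} {c : ℝ} (h : Servable w S (T.filter P) c) :
    ∃ ys, List.Forall₂ (fun x r => P r = true → ServedBy S x r) ys T ∧ listCost w S ys ≤ c := by
  obtain ⟨xs, h1, h2⟩ := h
  cases xs with
  | nil =>
    obtain ⟨ys, h3, h4⟩ := exists_extend_filter_from (w := w) P T _ h1
      (Classical.arbitrary (∀ i, M i))
    exact ⟨ys, h3, (listCost_le_cons hw _ _).trans (h4.trans_le h2)⟩
  | cons x xs =>
    obtain ⟨ys, h3, h4⟩ := exists_extend_filter_from (w := w) P T _ h1 x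
    refine ⟨ys, h3, (listCost_le_cons hw x _).trans (h4.trans_le ?_)⟩
    rwa [listCost, switchCost_self, zero_add]

open Classical in
/-- If, for more than `mergeBound` many points `q`, the requests in `T` that do not ask for `q` can
be served cheaply, then all requests in `T` can be served cheaply. -/
theorem servable_of_filter [Nonempty (∀ i, M i)] (hw : ∀ i, 0 < w i) {S : Finset ι} {m : ι}
    {Q : Finset (M m)} {T : List (∀ i, M i)} {c : ℝ} (hQ : mergeBound S.card < Q.card)
    (h : ∀ q ∈ Q, Servable w S (T.filter (fun r => r m ≠ q)) c) :
    Servable w S T (S.card * (Q.card * c)) := by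
  obtain ⟨Φ, hserve, hcost⟩ := exists_merge (M := M) hw (M m) S
  have h' : ∀ q, ∃ ys, q ∈ Q → List.Forall₂ (fun x r => r m ≠ q → ServedBy S x r) ys T ∧
      listCost w S ys ≤ c := fun q => by
    by_cases hq : q ∈ Q
    · obtain ⟨ys, h1, h2⟩ := (h q hq).extend_filter hw
      exact ⟨ys, fun _ => ⟨by simpa using h1, h2⟩⟩
    · exact ⟨[], fun h => absurd h hq⟩
  choose ys hys using h'
  let x₀ : ∀ i, M i := Classical.arbitrary _
  -- The solutions are transposed into a list of families indexed by `q`. The default `x₀` only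
  -- appears for `q ∉ Q`.
  let Z : List (M m → ∀ i, M i) :=
    (List.range T.length).map fun t q => (ys q).getD t x₀
  have hZ : ∀ q ∈ Q, (Z.map fun x => x q) = ys q := fun q hq => by
    refine List.ext_getElem ?_ fun t h1 h2 => ?_
    · simp [Z, (hys q hq).1.length_eq]
    · simp [Z, h2]
  refine ⟨Z.map (Φ Q), ?_, (listCost_map_le (Q := Q) (hcost Q) Z).trans ?_⟩
  · rw [List.forall₂_iff_get]
    refine ⟨by simp [Z], fun t h1 h2 => ?_⟩
    simp only [List.get_eq_getElem, List.getElem_map]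
    refine hserve _ _ _ (lt_of_le_of_lt ?_ hQ)
    refine (Nat.mul_le_mul_right _ (?_ : _ ≤ 1)).trans (one_mul _).le
    -- The solution indexed by `q` can fail on `T[t]` only if `q = T[t] m`.
    refine (Finset.card_le_card (t := {T[t] m}) fun q hq => ?_).trans
      (Finset.card_singleton _).le
    rw [Finset.mem_filter] at hq
    rw [Finset.mem_singleton]
    by_contra hne
    refine hq.2 ?_
    have h3 := (List.forall₂_iff_get.1 (hys q hq.1).1)
    have h4 := h3.2 t (h3.1 ▸ h2) h2 (Ne.symm hne)
    have h5 : t < (ys q).length := h3.1 ▸ h2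
    simpa [Z, h5] using h4
  · refine mul_le_mul_of_nonneg_left ?_ (Nat.cast_nonneg _)
    rw [← nsmul_eq_mul]
    refine Finset.sum_le_card_nsmul _ _ _ fun q hq => ?_
    rw [hZ q hq]
    exact (hys q hq).2

end Merge

/-! ### The recursive online algorithm and its analysis -/

section Algorithm

variable {ι : Type*} {M : ι → Type*} {w : ι → ℝ}

/-- The cost, for the servers in `S`, of the states `f` of an algorithm on the requests `σ`. -/
noncomputable def runCost (w : ι → ℝ) (S : Finset ι)
    (f : List (∀ i, M i) → ∀ i, M i) (σ : List (∀ i, M i)) : ℝ :=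
  ∑ t ∈ Finset.range σ.length, switchCost w S (f (σ.take t)) (f (σ.take (t + 1)))

theorem runCost_nil {S : Finset ι} (f : List (∀ i, M i) → ∀ i, M i) : runCost w S f [] = 0 := by
  simp [runCost]

theorem runCost_concat {S : Finset ι} (f : List (∀ i, M i) → ∀ i, M i) (σ : List (∀ i, M i))
    (r : ∀ i, M i) :
    runCost w S f (σ ++ [r]) = runCost w S f σ + switchCost w S (f σ) (f (σ ++ [r])) := by
  unfold runCost
  rw [List.length_append, List.length_singleton, Finset.sum_range_succ]
  congr 1
  · refine Finset.sum_congr rfl fun t ht => ?_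
    rw [Finset.mem_range] at ht
    rw [List.take_append_of_le_length ht.le, List.take_append_of_le_length ht]
  · rw [List.take_left', List.take_of_length_le] <;> simp

/-- There is an online algorithm for the servers in `S` whose cost is, up to an additive term of
`G` times the largest weight, at most `G` times the cost of every offline solution. -/
def HasAlgorithm (M : ι → Type*) (w : ι → ℝ) (S : Finset ι) (G : ℝ) : Prop :=
  ∃ A : (∀ i, M i) → List (∀ i, M i) → ∀ i, M i,
    (∀ q, A q [] = q) ∧
    (S.Nonempty → ∀ q l r, ServedBy S (A q (l ++ [r])) r) ∧
    ∀ b, 0 ≤ b → (∀ i ∈ S, w i ≤ b) → ∀ q σ c, Servable w S σ c →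
      runCost w S (A q) σ ≤ G * (c + b)

/-- The state of the algorithm for the servers `insert m S` that is built from an algorithm for the
servers in `S`. -/
structure RoundState (M : ι → Type*) (m : ι) where
  /-- the configuration at the beginning of the current round -/
  base : ∀ i, M i
  /-- the requests of the current round that are not served by server `m` -/
  fed : List (∀ i, M i)
  /-- the position of server `m` -/
  pos : M m
  /-- all requests of the current phase -/
  phase : List (∀ i, M i)

namespace RoundState

variable [DecidableEq ι] {m : ι}

/-- The configuration of the algorithm. -/
def output (A : (∀ i, M i) → List (∀ i, M i) → ∀ i, M i) (s : RoundState M m) : ∀ i, M i :=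
  Function.update (A s.base s.fed) m s.pos

/-- The initial state. -/
def init (m : ι) (q : ∀ i, M i) : RoundState M m := ⟨q, [], q m, []⟩

open Classical in
/-- Server `m` stays put as long as the servers in `S` can serve the current round at cost `W`.
Then it moves to a point that would have made the whole phase cheap for the servers in `S`. If there
is no such point, a new phase begins. -/
noncomputable def step (w : ι → ℝ) (S : Finset ι)
    (A : (∀ i, M i) → List (∀ i, M i) → ∀ i, M i) (W : ℝ) (s : RoundState M m) (r : ∀ i, M i) :
    RoundState M m :=
  if r m = s.pos then { s with phase := s.phase ++ [r] }
  else if Servable w S (s.fed ++ [r]) W then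
    { s with fed := s.fed ++ [r], phase := s.phase ++ [r] }
  else if h : ∃ p, Servable w S ((s.phase ++ [r]).filter (fun r => r m ≠ p)) (w m) then
    { base := A s.base s.fed
      -- The request that broke the round opens the next one, unless `m` has just moved to its
      -- point.
      fed := [r].filter (fun r => r m ≠ h.choose)
      pos := h.choose
      phase := s.phase ++ [r] }
  else
    { base := A s.base s.fed
      fed := []
      pos := r m
      phase := [r] }

open Classical in
/-- What holds for the state after the requests `σ` have been served at cost `total`, if `d` phases
have been completed and `Q` is the set of points to which server `m` has moved in the current
phase. -/
structure Invariant (w : ι → ℝ) (S : Finset ι)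
    (A : (∀ i, M i) → List (∀ i, M i) → ∀ i, M i) (W R : ℝ) (σ : List (∀ i, M i)) (total : ℝ)
    (d : ℕ) (Q : Finset (M m)) (s : RoundState M m) : Prop where
  cost : total ≤ (d * (mergeBound S.card + 1) + Q.card) * R + w m + runCost w S (A s.base) s.fed
  opt : ∀ τ c, Servable w (insert m S) (σ ++ τ) c →
    Servable w (insert m S) (s.phase ++ τ) (c - d * w m)
  fed_servable : Servable w S s.fed W
  fed_sublist : s.fed.Sublist (s.phase.filter (fun r => r m ≠ s.pos))
  witness : Q = ∅ ∨ ∃ T, T.Sublist s.phase ∧ ¬ Servable w S T W ∧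
    ∀ q ∈ Q, Servable w S (T.filter (fun r => r m ≠ q)) (w m)
  used : ∀ q ∈ Q, q ≠ s.pos → ¬ Servable w S (s.phase.filter (fun r => r m ≠ q)) (w m)

variable {S : Finset ι} {A : (∀ i, M i) → List (∀ i, M i) → ∀ i, M i} {W R : ℝ}

theorem switchCost_update (hm : m ∉ S) (a b : ∀ i, M i) (p : M m) :
    switchCost w (insert m S) (Function.update a m p) (Function.update b m p) =
      switchCost w S a b := by
  classical
  rw [switchCost_insert hm]
  simp only [Function.update_self, if_true, zero_add]
  exact switchCost_congr
    (fun i hi => Function.update_of_ne (ne_of_mem_of_not_mem hi hm) _ _)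
    (fun i hi => Function.update_of_ne (ne_of_mem_of_not_mem hi hm) _ _)

theorem switchCost_update_le (hw : ∀ i, 0 < w i) (hm : m ∉ S) (a b : ∀ i, M i) (p p' : M m) :
    switchCost w (insert m S) (Function.update a m p) (Function.update b m p') ≤
      w m + switchCost w S a b := by
  classical
  rw [switchCost_insert hm]
  refine add_le_add ?_ (switchCost_congr
    (fun i hi => Function.update_of_ne (ne_of_mem_of_not_mem hi hm) _ _)
    (fun i hi => Function.update_of_ne (ne_of_mem_of_not_mem hi hm) _ _)).le
  split_ifs
  exacts [(hw m).le, le_rfl]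

theorem servedBy_output_step (hm : m ∉ S)
    (hA : S.Nonempty → ∀ q l r, ServedBy S (A q (l ++ [r])) r) (s : RoundState M m)
    (r : ∀ i, M i) : ServedBy (insert m S) ((s.step w S A W r).output A) r := by
  have hpos : ∀ s' : RoundState M m, r m = s'.pos → ServedBy (insert m S) (s'.output A) r :=
    fun s' h => ⟨m, Finset.mem_insert_self _ _, by simp [output, h]⟩
  have hfed : ∀ (s' : RoundState M m) (T l : List (∀ i, M i)) (c : ℝ), Servable w S T c →
      r ∈ T → s'.fed = l ++ [r] → ServedBy (insert m S) (s'.output A) r := by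
    intro s' T l c hT hr hl
    -- An empty `S` can serve only the empty list, so no request is ever handed to `A` in that case.
    have hS : S.Nonempty := by
      rw [Finset.nonempty_iff_ne_empty]
      rintro rfl
      simp [hT.eq_nil] at hr
    obtain ⟨i, hi, h⟩ := hA hS s'.base l r
    refine ⟨i, Finset.mem_insert_of_mem hi, ?_⟩
    rw [output, hl, Function.update_of_ne (ne_of_mem_of_not_mem hi hm), h]
  unfold step
  split_ifs with h1 h2 h3
  · exact hpos _ h1
  · exact hfed _ _ s.fed _ h2 (by simp) rfl
  · have hp := h3.choose_spec
    generalize h3.choose = p at hp ⊢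
    by_cases hr : r m = p
    · exact hpos _ hr
    · exact hfed _ _ [] _ hp (by simp [hr]) (by simp [hr])
  · exact hpos _ rfl

/-- More than `N = mergeBound S.card` targets would merge into a solution for the witness `T` of
cost at most `W`. Thinning `Q` to exactly `N + 1` points makes this cost at most `S.card * (N + 1) *
w m`, which explains the size of `W`. -/
theorem Invariant.card_le [Nonempty (∀ i, M i)] (hw : ∀ i, 0 < w i)
    (hW : (mergeBound S.card + 1) * (S.card + 1) * w m ≤ W) {σ : List (∀ i, M i)}
    {total : ℝ} {d : ℕ} {Q : Finset (M m)} {s : RoundState M m}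
    (h : Invariant w S A W R σ total d Q s) : Q.card ≤ mergeBound S.card := by
  rcases h.witness with rfl | ⟨T, -, hT, hQ⟩
  · simp
  by_contra! hlt
  obtain ⟨Q', hQ', hcard⟩ := Finset.exists_subset_card_eq (Nat.succ_le_of_lt hlt)
  refine hT ((servable_of_filter hw (Q := Q') (by omega) fun q hq => hQ q (hQ' hq)).mono ?_)
  refine le_trans ?_ hW
  rw [hcard]
  push_cast
  have : 0 ≤ ((mergeBound S.card : ℝ) + 1) * w m := mul_nonneg (by positivity) (hw m).le
  nlinarith

theorem Invariant.init (hw : ∀ i, 0 < w i) (hW : 0 ≤ W) (q : ∀ i, M i) :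
    Invariant w S A W R [] 0 0 ∅ (RoundState.init m q) where
  cost := by simp [RoundState.init, runCost_nil, (hw m).le]
  opt := by simp [RoundState.init]
  fed_servable := servable_nil hW
  fed_sublist := by simp [RoundState.init]
  witness := Or.inl rfl
  used := by simp

/-- Each finished round is charged `R`, which covers one move of `m` and one run of `A`. The running
round is accounted for by the remaining `w m` and the cost of `A` so far. -/
theorem Invariant.step [Nonempty (∀ i, M i)] (hw : ∀ i, 0 < w i) (hm : m ∉ S)
    (hA : ∀ q, A q [] = q)
    (hW : (mergeBound S.card + 1) * (S.card + 1) * w m ≤ W)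
    (hR : ∀ q σ, Servable w S σ W → w m + runCost w S (A q) σ ≤ R)
    {σ : List (∀ i, M i)} {total : ℝ} {d : ℕ} {Q : Finset (M m)} {s : RoundState M m}
    (h : Invariant w S A W R σ total d Q s) (r : ∀ i, M i) :
    ∃ d' Q', Invariant w S A W R (σ ++ [r])
      (total + switchCost w (insert m S) (s.output A) ((s.step w S A W r).output A)) d' Q'
      (s.step w S A W r) := by
  classical
  have hwW : w m ≤ W := by
    refine le_trans (le_mul_of_one_le_left (hw m).le ?_) hW
    have h1 : (0 : ℝ) ≤ mergeBound S.card := Nat.cast_nonneg _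
    have h2 : (0 : ℝ) ≤ S.card := Nat.cast_nonneg _
    nlinarith
  have hopt : ∀ τ c, Servable w (insert m S) (σ ++ [r] ++ τ) c →
      Servable w (insert m S) (s.phase ++ [r] ++ τ) (c - d * w m) := fun τ c hc => by
    rw [List.append_assoc] at hc ⊢
    exact h.opt _ _ hc
  have hused : ∀ q ∈ Q, q ≠ s.pos →
      ¬ Servable w S ((s.phase ++ [r]).filter (fun r => r m ≠ q)) (w m) :=
    fun q hq hne hs => h.used q hq hne (hs.sublist hw ((List.sublist_append_left _ _).filter _))
  have hround := hR s.base s.fed h.fed_servable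
  -- `A` restarts from the configuration it has reached, so beginning a round costs one move of `m`
  -- and at most one step of `A`.
  have hmove : ∀ l : List (∀ i, M i), l.length ≤ 1 → ∀ p : M m,
      switchCost w (insert m S) (s.output A) (Function.update (A (A s.base s.fed) l) m p) ≤
        w m + runCost w S (A (A s.base s.fed)) l := by
    intro l hl p
    refine (switchCost_update_le hw hm _ _ _ _).trans (add_le_add le_rfl ?_)
    match l, hl with
    | [], _ => rw [hA, switchCost_self, runCost_nil]
    | [x], _ => rw [← List.nil_append [x], runCost_concat, runCost_nil, hA, zero_add]
  have hcost := h.cost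
  unfold RoundState.step
  split_ifs with h1 h2 h3
  · refine ⟨d, Q, ?_, hopt, h.fed_servable, ?_, ?_, hused⟩
    · rw [show RoundState.output A { s with phase := s.phase ++ [r] } = s.output A from rfl,
        switchCost_self, add_zero]
      exact hcost
    · exact h.fed_sublist.trans ((List.sublist_append_left _ _).filter _)
    · exact h.witness.imp_right fun ⟨T, hT, h'⟩ => ⟨T, hT.trans (List.sublist_append_left _ _), h'⟩
  · refine ⟨d, Q, ?_, hopt, h2, ?_, ?_, hused⟩
    · simp only [output]
      rw [switchCost_update hm, runCost_concat]
      linarith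
    · simp only [List.filter_append]
      exact h.fed_sublist.append (by simp [h1])
    · exact h.witness.imp_right fun ⟨T, hT, h'⟩ => ⟨T, hT.trans (List.sublist_append_left _ _), h'⟩
  · have hp := h3.choose_spec
    set p := h3.choose
    have hsub : (s.fed ++ [r]).Sublist ((s.phase ++ [r]).filter (fun r => r m ≠ s.pos)) := by
      rw [List.filter_append]
      exact h.fed_sublist.append (by simp [h1])
    -- The current position is disqualified as a target because the round just broke and `w m ≤ W`.
    -- Earlier targets remain disqualified since the phase only grows. Hence `p` is new.
    have hpos : ¬ Servable w S ((s.phase ++ [r]).filter (fun r => r m ≠ s.pos)) (w m) :=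
      fun hs => h2 ((hs.mono hwW).sublist hw hsub)
    have hpQ : p ∉ Q := fun hpQ => by
      by_cases hps : p = s.pos
      · exact hpos (hps ▸ hp)
      · exact hused p hpQ hps hp
    have hrsub : ([r].filter fun r => r m ≠ p).Sublist
        ((s.phase ++ [r]).filter fun r => r m ≠ p) := (List.sublist_append_right _ _).filter _
    refine ⟨d, insert p Q, ?_, hopt, ?_, hrsub, Or.inr ?_, ?_⟩
    · rw [Finset.card_insert_of_notMem hpQ]
      push_cast
      have := hmove ([r].filter fun r => r m ≠ p) (List.length_filter_le _ _) p
      simp only [output] at this ⊢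
      linarith
    · exact (hp.mono hwW).sublist hw hrsub
    -- The first jump of a phase fixes the witness: the list that broke the round. Later targets
    -- make the whole phase cheap, hence also this sublist.
    · rcases h.witness with rfl | ⟨T, hT, hT', hQ⟩
      · refine ⟨_, hsub.trans List.filter_sublist, h2, fun q hq => ?_⟩
        obtain rfl : q = p := by simpa using hq
        exact hp.sublist hw ((hsub.trans List.filter_sublist).filter _)
      · have hT2 := hT.trans (List.sublist_append_left s.phase [r])
        refine ⟨T, hT2, hT', fun q hq => ?_⟩
        rcases Finset.mem_insert.1 hq with rfl | hq
        · exact hp.sublist hw (hT2.filter _)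
        · exact hQ q hq
    · intro q hq hne
      by_cases hqs : q = s.pos
      · rwa [hqs]
      · exact hused q ((Finset.mem_insert.1 hq).resolve_left hne) hqs
  · refine ⟨d + 1, ∅, ?_, ?_, servable_nil ((hw m).le.trans hwW), List.nil_sublist _, Or.inl rfl,
      by simp⟩
    · have hcard : (Q.card : ℝ) ≤ mergeBound S.card := by exact_mod_cast h.card_le hw hW
      have hR0 : 0 ≤ R := by
        have := hR s.base [] (servable_nil ((hw m).le.trans hwW))
        rw [runCost_nil] at this
        linarith [hw m]
      have := hmove [] (by simp) (r m)
      have := mul_le_mul_of_nonneg_right hcard hR0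
      simp only [output, Finset.card_empty] at *
      push_cast
      linarith
    · intro τ c hc
      have := (hopt τ c hc)
      rw [List.append_assoc] at this
      -- The request `r` closes the old phase and opens the new one. The optimum is charged only up
      -- to the configuration serving `r`, so nothing is charged twice.
      have := this.drop hw (not_exists.1 h3)
      refine this.mono (le_of_eq ?_)
      push_cast
      ring

end RoundState

-- The factor is `(N + 1) * R / w m` with `N = mergeBound S.card`: at most `N + 1` rounds per phase
-- at cost `R` each, against `w m` paid offline per completed phase. The unfinished phase is paid
-- for by `b`.
open RoundState in
theorem HasAlgorithm.insert [DecidableEq ι] (hw : ∀ i, 0 < w i) {m : ι} {S : Finset ι}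
    (hm : m ∉ S) (hmax : ∀ i ∈ S, w i ≤ w m) {G : ℝ} (h : HasAlgorithm M w S G) :
    HasAlgorithm M w (insert m S) ((mergeBound S.card + 1) *
      (1 + G * ((mergeBound S.card + 1) * (S.card + 1)) + G)) := by
  obtain ⟨A, hnil, hserve, hcost⟩ := h
  set W : ℝ := (mergeBound S.card + 1) * (S.card + 1) * w m with hW
  set R : ℝ := w m + G * (W + w m) with hR
  let B (q : ∀ i, M i) (σ : List (∀ i, M i)) : ∀ i, M i :=
    (σ.foldl (step w S A W) (init m q)).output A
  refine ⟨B, fun q => ?_, fun _ q l r => ?_, fun b _ hb q σ c hc => ?_⟩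
  · simp [B, init, output, hnil]
  · simp only [B, List.foldl_append, List.foldl_cons, List.foldl_nil]
    exact servedBy_output_step hm hserve _ _
  · have : Nonempty (∀ i, M i) := ⟨q⟩
    have hround : ∀ q σ, Servable w S σ W → w m + runCost w S (A q) σ ≤ R := fun q σ hσ =>
      add_le_add le_rfl (hcost _ (hw m).le hmax _ _ _ hσ)
    have hW0 : 0 ≤ W := mul_nonneg (by positivity) (hw m).le
    obtain ⟨d, Q, hinv⟩ : ∃ d Q, Invariant w S A W R σ (runCost w (Insert.insert m S) (B q) σ) d Q
        (σ.foldl (step w S A W) (init m q)) := by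
      clear hc
      induction σ using List.reverseRecOn with
      | nil =>
        rw [runCost_nil]
        exact ⟨0, ∅, Invariant.init hw hW0 q⟩
      | append_singleton σ r ih =>
        obtain ⟨d, Q, ih⟩ := ih
        rw [runCost_concat]
        simp only [B, List.foldl_append, List.foldl_cons, List.foldl_nil]
        exact ih.step hw hm hnil le_rfl hround r
    have hcard : (Q.card : ℝ) ≤ mergeBound S.card := by exact_mod_cast hinv.card_le hw le_rfl
    have hR0 : 0 ≤ R := by
      have := hround q [] (servable_nil hW0)
      rw [runCost_nil] at this
      linarith [hw m]
    have h1 := hinv.cost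
    have h2 := hround (σ.foldl (step w S A W) (init m q)).base _ hinv.fed_servable
    have h3 := (hinv.opt [] c (by simpa using hc)).nonneg hw
    have h4 : runCost w (Insert.insert m S) (B q) σ ≤
        (d + 1) * ((mergeBound S.card + 1) * R) := by
      have := mul_le_mul_of_nonneg_right hcard hR0
      linarith
    have h5 : (mergeBound S.card + 1) * R = (mergeBound S.card + 1) *
        (1 + G * ((mergeBound S.card + 1) * (S.card + 1)) + G) * w m := by
      rw [hR, hW]; ring
    have h6 : 0 ≤ ((mergeBound S.card : ℝ) + 1) *
        (1 + G * ((mergeBound S.card + 1) * (S.card + 1)) + G) := by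
      refine nonneg_of_mul_nonneg_left ?_ (hw m)
      rw [← h5]
      exact mul_nonneg (by positivity) hR0
    rw [h5] at h4
    -- What remains of `c` after `d` completed phases is nonnegative, so `d * w m ≤ c`.
    have h7 : (d + 1) * w m ≤ c + b := by
      have := hb m (Finset.mem_insert_self _ _)
      linarith
    refine h4.trans ((le_of_eq ?_).trans (mul_le_mul_of_nonneg_left h7 h6))
    ring

/-- The competitive ratio for `ℓ` servers. -/
def ratio : ℕ → ℕ
  | 0 => 0
  | ℓ + 1 => (mergeBound ℓ + 1) * (1 + ratio ℓ * ((mergeBound ℓ + 1) * (ℓ + 1)) + ratio ℓ)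

theorem hasAlgorithm_ratio [DecidableEq ι] (hw : ∀ i, 0 < w i) (S : Finset ι) :
    HasAlgorithm M w S (ratio S.card) := by
  induction S using Finset.induction_on_max_value w with
  | empty =>
    refine ⟨fun q _ => q, fun _ => rfl, fun h => absurd h (by simp), fun b _ _ q σ c _ => ?_⟩
    simp [ratio, runCost, switchCost]
  | insert m S hm hmax ih =>
    have := ih.insert hw hm hmax
    rw [Finset.card_insert_of_notMem hm, ratio]
    exact_mod_cast this

/-- With `a = 2 ^ 2 ^ ℓ = 2 * mergeBound ℓ` the claim reads `ratio ℓ < a ^ 8`, and the next one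
`ratio (ℓ + 1) < a ^ 16`. The recursion gives at most `a * (1 + a ^ 10 + a ^ 8)`, well below that.
-/
theorem ratio_lt (ℓ : ℕ) : ratio ℓ < 2 ^ 2 ^ (ℓ + 3) := by
  induction ℓ with
  | zero => simp [ratio]
  | succ ℓ ih =>
    have hn := two_mul_mergeBound ℓ
    have hpos := mergeBound_pos ℓ
    obtain ⟨a, ha⟩ : ∃ a, a = 2 ^ 2 ^ ℓ := ⟨_, rfl⟩
    have hℓ : ℓ + 1 ≤ a := by
      rw [ha]
      exact (Nat.lt_two_pow_self).trans (Nat.lt_two_pow_self)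
    have h8 : 2 ^ 2 ^ (ℓ + 3) = a ^ 8 := by rw [ha, ← pow_mul, pow_add]; norm_num
    have h16 : 2 ^ 2 ^ (ℓ + 1 + 3) = a ^ 16 := by
      rw [ha, ← pow_mul, pow_add, pow_add, mul_assoc]; norm_num
    have hna : mergeBound ℓ + 1 ≤ a := by omega
    have ha2 : 2 ≤ a := by omega
    rw [h8] at ih
    rw [h16, ratio]
    have h1 : (mergeBound ℓ + 1) * (ℓ + 1) ≤ a * a := Nat.mul_le_mul hna hℓ
    have h2 : ratio ℓ * ((mergeBound ℓ + 1) * (ℓ + 1)) ≤ a ^ 8 * (a * a) :=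
      Nat.mul_le_mul ih.le h1
    have h3 : 1 + a ^ 8 * (a * a) + a ^ 8 < a ^ 15 := by
      have h4 : a ^ 15 = a ^ 8 * (a * a) * a ^ 5 := by ring
      have h5 : 2 ^ 5 ≤ a ^ 5 := Nat.pow_le_pow_left ha2 5
      have h6 : a ^ 8 * 1 ≤ a ^ 8 * (a * a) := Nat.mul_le_mul_left _ (by nlinarith)
      have h7 : 1 ≤ a ^ 8 := Nat.one_le_pow _ _ (by omega)
      have h9 : a ^ 8 * (a * a) * 2 ^ 5 ≤ a ^ 8 * (a * a) * a ^ 5 := Nat.mul_le_mul_left _ h5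
      omega
    calc (mergeBound ℓ + 1) * (1 + ratio ℓ * ((mergeBound ℓ + 1) * (ℓ + 1)) + ratio ℓ)
        ≤ a * (1 + a ^ 8 * (a * a) + a ^ 8) := Nat.mul_le_mul hna (by omega)
      _ < a * a ^ 15 := Nat.mul_lt_mul_of_pos_left h3 (by omega)
      _ = a ^ 16 := by ring

end Algorithm

/-! ### Back to metric costs and the infimum over offline solutions -/

theorem moveCost_eq_switchCost {k : ℕ} {M : Fin k → Type*} [∀ i, MetricSpace (M i)]
    {w : Fin k → ℝ} (hw : IsWeightedUniform M w) (p q : Config M) :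
    moveCost p q = switchCost w Finset.univ p q := by
  classical
  refine Finset.sum_congr rfl fun i _ => ?_
  split_ifs with h
  · rw [h, dist_self]
  · exact (hw i).2 _ _ h

end GenKServer

theorem theorem3 (k : ℕ) (hk : 1 ≤ k) (M : Fin k → Type*) [∀ i, MetricSpace (M i)]
    (w : Fin k → ℝ) (hw : GenKServer.IsWeightedUniform M w) :
    ∃ A : GenKServer.OnlineAlgorithm M, A.IsCompetitive ((2 : ℝ) ^ (2 ^ (k + 3))) := by
  have hw0 : ∀ i, 0 < w i := fun i => (hw i).1
  have : NeZero k := ⟨by omega⟩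
  obtain ⟨A, hnil, hserve, hcost⟩ :=
    GenKServer.hasAlgorithm_ratio (M := M) hw0 Finset.univ
  refine ⟨⟨A, hnil, fun q l r => ?_⟩, ?_⟩
  · obtain ⟨i, -, hi⟩ := hserve Finset.univ_nonempty q l r
    exact ⟨i, hi⟩
  set C : ℝ := (2 : ℝ) ^ (2 ^ (k + 3)) with hC
  have hC0 : 0 < C := by positivity
  have hratio : (GenKServer.ratio (Finset.univ : Finset (Fin k)).card : ℝ) ≤ C := by
    rw [Finset.card_univ, Fintype.card_fin, hC]
    exact_mod_cast (GenKServer.ratio_lt k).le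
  have hsum : 0 ≤ ∑ i, w i := Finset.sum_nonneg fun i _ => (hw0 i).le
  -- The sum of the weights bounds each weight and depends on neither `q₀` nor `σ`.
  refine ⟨C * ∑ i, w i, fun q₀ σ => ?_⟩
  -- The bound is rewritten as a lower bound on every single offline cost, so that it passes to the
  -- infimum.
  have hle : ∀ c ∈ GenKServer.offlineCosts q₀ σ,
      (GenKServer.runCost w Finset.univ (A q₀) σ - C * ∑ i, w i) / C ≤ c := by
    rintro c ⟨q, ⟨-, hq⟩, rfl⟩
    obtain ⟨xs, h1, h2⟩ := GenKServer.servable_of_path (w := w) (S := Finset.univ) σ q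
      fun t ht => by
        obtain ⟨i, hi⟩ := hq t ht
        exact ⟨i, Finset.mem_univ i, hi⟩
    have h3 : GenKServer.Servable w Finset.univ σ (GenKServer.pathCost q σ.length) := by
      refine ⟨xs, h1, (GenKServer.listCost_le_cons hw0 _ _).trans (h2.trans_eq ?_)⟩
      exact Finset.sum_congr rfl fun t _ => (GenKServer.moveCost_eq_switchCost hw _ _).symm
    have h4 := hcost (∑ i, w i) hsum
      (fun i hi => Finset.single_le_sum (fun i _ => (hw0 i).le) hi) q₀ σ _ h3
    have h5 := mul_le_mul_of_nonneg_right hratio (add_nonneg (h3.nonneg hw0) hsum)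
    rw [div_le_iff₀ hC0]
    linarith
  have h := le_csInf (GenKServer.offlineCosts_nonempty hk q₀ σ) hle
  rw [div_le_iff₀ hC0] at h
  have hrun : GenKServer.OnlineAlgorithm.cost ⟨A, hnil, fun q l r => by
      obtain ⟨i, -, hi⟩ := hserve Finset.univ_nonempty q l r
      exact ⟨i, hi⟩⟩ q₀ σ = GenKServer.runCost w Finset.univ (A q₀) σ := by
    unfold GenKServer.OnlineAlgorithm.cost GenKServer.pathCost GenKServer.runCost
    exact Finset.sum_congr rfl fun t _ => GenKServer.moveCost_eq_switchCost hw _ _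
  rw [hrun, GenKServer.optCost]
  linarith
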